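/- **Setting.** Nodes (autonomous domains, ADs) run a distributed declarative program. A *tuple* $p(@x,\vec v)$ has a name, a location $x$ (its first argument) and further arguments; values are node names, numbers (also bit strings) and lists. A program of node $n$ consists of base tuples located at $n$, derivation rules "head :- body tuples, constraints", and a set of names of tuples received from the network; tuples with other names are derived locally and are never taken from the network. A node's state is a table $\Psi$ of tuples with reference counts, a list of unprocessed updates $\pm p$ (insertions and deletions), and its program. From the empty state it may load its base tuples as insertions. It processes the first update of its list as follows: if this inserts a tuple $q$ not in $\Psi$, then for each rule and each body position $i$ it generates a list of updates in which every insertion is the instance of the rule head under a substitution that satisfies the constraints and maps the $i$-th body tuple to $q$, earlier body tuples into $\Psi\uplus\{q\}$ and later ones into $\Psi$ (which of these instances are chosen, and which stored tuples with the name of the head are withdrawn, is left open); if it deletes the last copy of a tuple, head instances are deleted in the same way; otherwise nothing is generated; finally the update is applied to $\Psi$. Updates located at the node itself are appended to its own list, the others to a global network queue, from which updates may be delivered, in order, to the nodes at which they are located. Other nodes may run arbitrary, possibly malicious code: they may change their state and emit any updates at any time. A *trace* is a finite sequence of transitions, starting in any configuration, with time stamps in a linear order that never decrease. Write $P@(n,t)$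 if node $n$ generated the insertion of $P$ at a time $\le t$. $\mathrm{Honest}(n)$ means that in the first configuration of the trace (time $-\infty$) $n$ is in the empty state of the program $\mathrm{scion}(n)$ below. The network is arbitrary. The signature and MAC schemes are arbitrary, subject to: an honestly generated signature verifies under the matching public key, and an honestly generated MAC verifies under its key. **Program $\mathrm{scion}(n)$.** Base tuples (arbitrary at each node): $\mathsf{coreTD}(@n,c,td,ctf)$ ($c$ is the core of trust domain $td$, with certificate $ctf$), $\mathsf{provider}(@n,m,ig)$ ($m$ is a provider of $n$, ingress interface $ig$), $\mathsf{customer}(@n,m,eg)$ ($m$ is a customer of $n$, egress interface $eg$), $\mathsf{privateKeys}(@n,k)$, $\mathsf{publicKeys}(@n,m,k)$. Network tuples: $\mathsf{beaconIni},\mathsf{beaconFwd},\mathsf{pathUpload}$. $\mathrm{last}$ is the last entry of a list, ${+}{+}$ concatenation, $l_{<j}$ the first $j$ entries, positions count from $0$; *now* is the reading of the local clock. $n$ is the location of all body tuples; *core* means that $\mathsf{coreTD}(@n,n,td,ctf)$ is in the body; $k$ is such that $\mathsf{privateKeys}(@n,k)$ is in the body. - b1 (core): from $\mathsf{beaconPrep}(@n,[td,\tau],sg,\tau)$,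 $\mathsf{customer}(@n,m,ceg)$, $\mathsf{mac}(@n,[ceg],h)$ and $k$ derive $\mathsf{signature}(@n,I,\mathrm{sign}(I,k),\tau)$, $I=[[n,ceg,m],[\tau],[[ceg,h]],[\,]]$. - b2 (core): with $k$ derive $\mathsf{signature}(@n,[td,\tau],\mathrm{sign}([td,\tau],k),\tau)$, $\tau=$ now. - b3 (core): from $\mathsf{customer}(@n,m,ceg)$ and $k$ derive $\mathsf{mac}(@n,[ceg],\mathrm{mac}([ceg],k))$. - b4 (core): from $\mathsf{signature}(@n,[td,\tau],sg,\tau)$ derive $\mathsf{beaconPrep}(@n,[td,\tau],sg,\tau)$. - b5 (core): from $\mathsf{beaconPrep}$, $\mathsf{customer}$, $\mathsf{mac}$ as in b1 and $\mathsf{signature}(@n,I,s,\tau)$ send $\mathsf{beaconIni}(@m,n,td,[n,ceg,m],[\tau],[[ceg,h]],[s],sg)$. - b6: from $\mathsf{beaconIni}(@n,c,td,[c,ceg,n],tl,[[ceg,mac]],sl,sg)$, $\mathsf{coreTD}(@n,c,td,ctf)$, $\mathsf{provider}(@n,c,ing)$ derive $\mathsf{beaconRev}(@n,td,ing,[c,ceg,n,ing],tl,[[ceg,mac]],sl,sg)$.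 - b7: from $\mathsf{beaconFwd}(@n,h,td,itf,tl,ol,sl,sg)$ with $itf=p{+}{+}[h,hig,heg,n]$, $ol=o{+}{+}[[hig,heg,mac]]$, and $\mathsf{provider}(@n,h,ing)$ derive $\mathsf{beaconRev}(@n,td,ing,itf{+}{+}[ing],tl,ol,sl,sg)$. - b8: from $\mathsf{beaconRev}(@n,td,ing,itf,tl,ol,sl,sg)$, with $c$ the first entry of $itf$, $\mathsf{coreTD}(@n,c,td,ctf)$, $\mathsf{publicKeys}(@n,c,pk)$, if $sg$ verifies for $[td,\tau]$ under $pk$, $\tau$ the first entry of $tl$, derive $\mathsf{beaconToVeri}(@n,td,itf,tl,ol,sl,sg,itf_{<3},0)$. - b9: from $\mathsf{beaconToVeri}(@n,td,itf,tl,ol,sl,sg,v,j)$ with $j<|sl|$ and $\mathsf{publicKeys}(@n,d,pk)$, where $d$ is the entry of $v$ at position $\max(|v|-4,0)$, if $sl_j$ verifies for $[v,tl_{<j+1},ol_{<j+1},sl_{<j}]$ under $pk$, derive the same tuple with $v,j$ replaced by $itf_{<|v|+3},\,j+1$. - b10: from $\mathsf{beaconToVeri}(@n,td,itf,tl,ol,sl,sg,v,|sl|)$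 with $|ol|=|tl|=|sl|$, $|itf|=3|sl|+1$ derive $\mathsf{verifiedBeacon}(@n,td,itf,tl,ol,sl,sg)$. - b11: from $\mathsf{verifiedBeacon}(@n,td,itf,tl,ol,sl,sg)$, $\mathsf{customer}(@n,m,neg)$, $\mathsf{mac}(@n,nig::neg::\mathrm{last}(ol),h)$ with $nig=\mathrm{last}(itf)$, and $k$, derive $\mathsf{signature}(@n,I',\mathrm{sign}(I',k),\tau)$, $\tau=$ now, $I'=[itf{+}{+}[neg,m],tl{+}{+}[\tau],ol{+}{+}[[nig,neg,h]],sl]$. - b12: from $\mathsf{verifiedBeacon}$, $\mathsf{customer}$ as in b11 and $k$ derive $\mathsf{mac}(@n,J,\mathrm{mac}(J,k))$, $J=nig::neg::\mathrm{last}(ol)$. - b13: from $\mathsf{verifiedBeacon}$, $\mathsf{customer}$, $\mathsf{mac}$ as in b11 and $\mathsf{signature}(@n,I',s,\tau)$ send $\mathsf{beaconFwd}(@m,n,td,itf{+}{+}[neg,m],tl{+}{+}[\tau],ol{+}{+}[[nig,neg,h]],sl{+}{+}[s],sg)$. - pc1: from $\mathsf{verifiedBeacon}(@n,td,itf,tl,ol,sl,sg)$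 derive $\mathsf{upPath}(@n,td,itf,\mathrm{reverse}(ol),tl)$. - pc2: from $\mathsf{upPath}(@n,td,itf,opqU,tl)$, $\mathsf{coreTD}(@n,c,td,ctf)$, $\mathsf{provider}(@n,m,\mathrm{last}(itf))$ send $\mathsf{pathUpload}(@m,n,n,c,itf,\mathrm{reverse}(opqU),opqU,0)$. - pc3: from $\mathsf{pathUpload}(@n,b,src,c,itf,opqD,opqU,pt)$ and $k$, if $opqU$ is well formed (its last entry is a pair, every other entry a triple), $pt+1<|opqU|$, $opqU_{pt}=[nig,neg,mac]$, $\mathsf{provider}(@n,m,nig)$, and $mac$ verifies for $nig::neg::opqU_{pt+1}$ under $k$, send $\mathsf{pathUpload}(@m,n,src,c,itf,opqD,opqU,pt+1)$. - pc4 (core): from $\mathsf{pathUpload}(@n,b,src,n,itf,opqD,opqU,pt)$ and $k$, if $opqU$ is well formed, $|opqU|=pt+1$, $opqU_{pt}=[ceg,mac]$, and $mac$ verifies for $[ceg]$ under $k$, derive $\mathsf{downPath}(@n,src,itf,opqD)$. **Good forwarding paths.** $\mathrm{goodFwdPath}(t,n,opqU,pt)$ holds iff one of the following holds: 1. $pt=0$;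 2. $opqU=o{+}{+}[[ceg,mac]]$, $pt=|opqU|$, and if $n$ is honest there are $t'\le t$, $m,td,ctf$ with $\mathsf{coreTD}(n,n,td,ctf)@(n,t')$ and $\mathsf{customer}(n,m,ceg)@(n,t')$; 3. $opqU=o{+}{+}[[nig,neg,mac'],[ceg,mac]]$, $pt=|o|+1$ (so $0<pt<|opqU|$), and if $n$ is honest there are $t'\le t$, nodes $h,m$ and $td',tl,sl,sg$ with $\mathsf{provider}(n,h,nig)@(n,t')$, $\mathsf{customer}(n,m,neg)@(n,t')$ and $\mathsf{verifiedBeacon}(n,td',[h,ceg,n,nig],tl,[[ceg,mac]],sl,sg)@(n,t')$; 4. $opqU=o{+}{+}[[nig,neg,mac'],[hig,heg,mac]]{+}{+}o''$, $pt=|o|+1$, and if $n$ is honest there are $t'\le t$, nodes $h,m$ and $td',tl,sl,sg,p',p''$ with $\mathsf{provider}(n,h,nig)@(n,t')$, $\mathsf{customer}(n,m,neg)@(n,t')$ and $\mathsf{verifiedBeacon}(n,td',p'{+}{+}[h,hig,heg,n,nig],tl,p''{+}{+}[[hig,heg,mac]],sl,sg)@(n,t')$. **MAC axiom $A'_{mac}$**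 (about a trace). For all $msg,m,k,n,t$: if at time $t$ node $n$ verifies that $m$ is a MAC of $msg$ under $k$ (it processes a new tuple and a rule instance with all body tuples and constraints satisfied contains this check), $\mathsf{privateKeys}(n,k)@(n,t)$, and $n$ is honest, then $\mathsf{mac}(n,msg,m)@(n,t')$ for some $t'<t$. **Theorem (data-path authenticity $\varphi_{authD}$).** On every trace that satisfies $A'_{mac}$: for all $m,n,t,src,core,itf,opqD,opqU,pt$, if $n$ is honest and $\mathsf{pathUpload}(@m,n,src,core,itf,opqD,opqU,pt)@(n,t)$, then $\mathrm{goodFwdPath}(t,n,opqU,pt)$. -/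

import Mathlib

/-! SANDLog (without aggregates): values, terms, rules, operational semantics, timed traces;
the SCION path-construction program; the property of the data path. -/

namespace Scion

universe u v

/-- Values: node identifiers, numbers (also used for bit strings), and lists of values. -/
inductive Val (N : Type u) : Type u where
  | node (n : N) : Val N
  | num (k : ℕ) : Val N
  | list (l : List (Val N)) : Val N

/-- A signature scheme and a MAC scheme, with their functional correctness and nothing about their
security. `pub` sends a private key to the matching public key. -/
structure Crypto (V : Type u) where
  pub : V → V
  sign : V → V → V
  verify : V → V → V → Bool
  mac : V → V → V
  verifyMac : V → V → V → Bool
  verify_sign : ∀ info k, verify info (sign info k) (pub k) = true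
  verifyMac_mac : ∀ info k, verifyMac info (mac info k) k = true

/-- Names of tuples. The first five are the base tuples. -/
inductive Pred : Type where
  | coreTD | provider | customer | privateKeys | publicKeys
  | signature | mac | beaconPrep | beaconIni | beaconRev | beaconToVeri | verifiedBeacon
  | beaconFwd | upPath | pathUpload | downPath

/-- Names of rule variables. -/
inductive Var : Type where
  | N | M | C | H | Nb | Nd | Src | Core
  | Td | Ctf | K | Pk
  | Info | MInfo | Glb | Sig | SigG | Time | Mac
  | Ing | Nig | Neg | Ceg | Hig | Heg
  | Itf | Itf1 | Itfv | Itfv1 | ItfP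
  | Tl | Tl1 | Ol | Ol1 | OlP | Sl | Sl1
  | OpqU | OpqD | Pos | Pos1 | Pt | Pt1

/-! ### Terms -/

/-- Unary built-in functions. -/
inductive Fn1 : Type where
  | first | last | size | reverse | wfOpq

/-- Binary built-in functions; `sub` is truncated subtraction. -/
inductive Fn2 : Type where
  | prepend | concat | nth | take | add | sub | sign | mac

/-- Ternary built-in functions. -/
inductive Fn3 : Type where
  | verify | verifyMac

/-- Terms; `now` is the reading of the local clock. -/
inductive Term (N : Type u) : Type u where
  | var (x : Var) : Term N
  | const (c : Val N) : Term N
  | now : Term N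
  | app1 (f : Fn1) (a : Term N) : Term N
  | app2 (f : Fn2) (a b : Term N) : Term N
  | app3 (f : Fn3) (a b c : Term N) : Term N

section Eval

variable {N : Type u}

/-- The elements of a list value (none for the other values). -/
def Val.elems : Val N → List (Val N)
  | .list l => l
  | _ => []

/-- The number in a numeric value (`0` for the other values). -/
def Val.toNat : Val N → ℕ
  | .num k => k
  | _ => 0

/-- The format of the opaque fields of an up path: the last field is that of the TD core, an egress
interface and a MAC; every other one is an ingress interface, an egress interface and a MAC. -/
def WellFormedOpq (v : Val N) : Prop :=
  ∃ (fs : List (Val N)) (ceg mac : Val N), v = .list (fs ++ [.list [ceg, mac]]) ∧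
    ∀ f ∈ fs, ∃ ig eg mac' : Val N, f = .list [ig, eg, mac']

open Classical in
noncomputable def Fn1.eval : Fn1 → Val N → Val N
  | .first, a => a.elems.headD (.list [])
  | .last, a => a.elems.getLastD (.list [])
  | .size, a => .num a.elems.length
  | .reverse, a => .list a.elems.reverse
  | .wfOpq, a => .num (if WellFormedOpq a then 1 else 0)

def Fn2.eval (cr : Crypto (Val N)) : Fn2 → Val N → Val N → Val N
  | .prepend, a, l => .list (a :: l.elems)
  | .concat, l, l' => .list (l.elems ++ l'.elems)
  | .nth, l, k => l.elems.getD k.toNat (.list [])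
  | .take, l, k => .list (l.elems.take k.toNat)
  | .add, j, k => .num (j.toNat + k.toNat)
  | .sub, j, k => .num (j.toNat - k.toNat)
  | .sign, info, k => cr.sign info k
  | .mac, info, k => cr.mac info k

def Fn3.eval (cr : Crypto (Val N)) : Fn3 → Val N → Val N → Val N → Val N
  | .verify, info, sig, k => .num (cr.verify info sig k).toNat
  | .verifyMac, info, m, k => .num (cr.verifyMac info m k).toNat

/-- The value of a term under a substitution `σ`, the local clock showing `now`. -/
noncomputable def Term.eval (cr : Crypto (Val N)) (now : ℕ) (σ : Var → Val N) : Term N → Val N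
  | .var x => σ x
  | .const c => c
  | .now => .num now
  | .app1 f a => f.eval (a.eval cr now σ)
  | .app2 f a b => f.eval cr (a.eval cr now σ) (b.eval cr now σ)
  | .app3 f a b c => f.eval cr (a.eval cr now σ) (b.eval cr now σ) (c.eval cr now σ)

end Eval

/-! ### Rules and programs -/

/-- Comparison operators; `lt` compares numbers. -/
inductive Bop : Type where
  | eq | lt

/-- Atoms: an assignment `x := t` or a comparison `t₁ bop t₂`. -/
inductive Atom (N : Type u) : Type u where
  | assign (x : Var) (t : Term N) : Atom N
  | cmp (op : Bop) (t₁ t₂ : Term N) : Atom N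

/-- A predicate applied to terms; the first argument is the location specifier. -/
structure Lit (N : Type u) : Type u where
  pred : Pred
  args : List (Term N)

/-- A rule `head :- body, atoms`, with at least one body tuple (rules without a body are the base
rules of a program). -/
structure Rule (N : Type u) : Type u where
  head : Lit N
  body : List (Lit N)
  atoms : List (Atom N)

/-- A ground tuple; the first argument is the location specifier. -/
@[ext] structure Tuple (N : Type u) : Type u where
  pred : Pred
  args : List (Val N)

/-- A program: base rules (name and arguments, the location specifier `ι` being left out), derivation
rules, and the names of the tuples that are received from the network. A tuple with any other name
is derived locally and is never taken from the network. -/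
structure Program (N : Type u) : Type u where
  base : List (Pred × List (Val N))
  rules : List (Rule N)
  net : Pred → Prop

section Semantics

variable {N : Type u}

/-- The constraint `[a]` that an atom represents. -/
def Atom.Holds (cr : Crypto (Val N)) (now : ℕ) (σ : Var → Val N) : Atom N → Prop
  | .assign x t => σ x = t.eval cr now σ
  | .cmp .eq t₁ t₂ => t₁.eval cr now σ = t₂.eval cr now σ
  | .cmp .lt t₁ t₂ => ∃ j k : ℕ, t₁.eval cr now σ = .num j ∧ t₂.eval cr now σ = .num k ∧ j < k

noncomputable def Lit.inst (cr : Crypto (Val N)) (now : ℕ) (σ : Var → Val N) (p : Lit N) :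
    Tuple N :=
  ⟨p.pred, p.args.map (Term.eval cr now σ)⟩

/-- The tuple has location specifier `@i`. -/
def Tuple.At (p : Tuple N) (i : N) : Prop := p.args.head? = some (.node i)

/-- Updates: insertion `+P` and deletion `-P`. -/
inductive Update (N : Type u) : Type u where
  | ins (p : Tuple N) : Update N
  | del (p : Tuple N) : Update N

def Update.tuple : Update N → Tuple N
  | .ins p => p
  | .del p => p

/-- A table of tuples with reference counts. -/
abbrev Table (N : Type u) : Type u := Multiset (Tuple N)

open Classical in
/-- `Ψ ⊎ u`: the reference count goes up by one for an insertion, down by one for a deletion. -/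
noncomputable def applyUpdate (Ψ : Table N) : Update N → Table N
  | .ins p => p ::ₘ Ψ
  | .del p => Ψ.erase p

/-- `σ ∈ ρ(Ψν, Ψ, r, i, q)`: the substitution unifies the `i`-th body tuple of `r` with the current
tuple `q`, the earlier ones with tuples of `Ψν`, the later ones with tuples of `Ψ`, and satisfies
the constraints. -/
def Rho (cr : Crypto (Val N)) (now : ℕ) (Ψν Ψ : Table N) (r : Rule N) (i : ℕ) (q : Tuple N)
    (σ : Var → Val N) : Prop :=
  (∃ p, r.body[i]? = some p ∧ p.inst cr now σ = q) ∧
  (∀ j p, j < i → r.body[j]? = some p → p.inst cr now σ ∈ Ψν) ∧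
  (∀ j p, i < j → r.body[j]? = some p → p.inst cr now σ ∈ Ψ) ∧
  ∀ a ∈ r.atoms, a.Holds cr now σ

open Classical in
/-- Firing the `Δ` rule of `r` for its `i`-th body tuple on an update, at node `ι`: internal updates
and external updates. The functions that select among the substitutions and that generate the
updates are left open: any list will do whose insertions come from substitutions in `ρ` and whose
deletions withdraw stored tuples with the name of the head. -/
inductive FireSingle (cr : Crypto (Val N)) (now : ℕ) (ι : N) (Ψ : Table N) :
    Update N → Rule N → ℕ → List (Update N) → List (Update N) → Prop
  | noMatch (w r i) (h : ∀ p, r.body[i]? = some p → p.pred ≠ w.tuple.pred) :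
      FireSingle cr now ι Ψ w r i [] []
  | insExists (q r i) (h : q ∈ Ψ) : FireSingle cr now ι Ψ (.ins q) r i [] []
  | insNew (q r i) (h : q ∉ Ψ) (U : List (Update N))
      (hU : ∀ w ∈ U,
        (∃ σ, Rho cr now (applyUpdate Ψ (.ins q)) Ψ r i q σ ∧ w = .ins (r.head.inst cr now σ)) ∨
        (∃ p ∈ applyUpdate Ψ (.ins q), p.pred = r.head.pred ∧ w = .del p)) :
      FireSingle cr now ι Ψ (.ins q) r i
        (U.filter fun w => w.tuple.At ι) (U.filter fun w => ¬ w.tuple.At ι)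
  | delExists (q r i) (h : Ψ.count q ≠ 1) : FireSingle cr now ι Ψ (.del q) r i [] []
  | delNew (q r i) (h : Ψ.count q = 1) (U : List (Update N))
      (hU : ∀ w ∈ U, ∃ σ, Rho cr now (applyUpdate Ψ (.del q)) Ψ r i q σ ∧
        w = .del (r.head.inst cr now σ)) :
      FireSingle cr now ι Ψ (.del q) r i
        (U.filter fun w => w.tuple.At ι) (U.filter fun w => ¬ w.tuple.At ι)

/-- The `Δ` rules of a list of rules: one for each rule and each of its body tuples. -/
def deltas (rs : List (Rule N)) : List (Rule N × ℕ) :=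
  rs.flatMap fun r => (List.range r.body.length).map fun i => (r, i)

/-- Firing a list of `Δ` rules, one after the other. -/
inductive FireRules (cr : Crypto (Val N)) (now : ℕ) (ι : N) (Ψ : Table N) (w : Update N) :
    List (Rule N × ℕ) → List (Update N) → List (Update N) → Prop
  | empty : FireRules cr now ι Ψ w [] [] []
  | seq (r i ds Ui Ue Ui' Ue') (h : FireSingle cr now ι Ψ w r i Ui Ue)
      (h' : FireRules cr now ι Ψ w ds Ui' Ue') :
      FireRules cr now ι Ψ w ((r, i) :: ds) (Ui ++ Ui') (Ue ++ Ue')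

/-- What a node runs: a SANDLog program, or arbitrary (possibly malicious) code. -/
inductive Code (N : Type u) : Type u where
  | prog (p : Program N) : Code N
  | arbitrary : Code N

/-- Local state of a node: table, unprocessed updates, code. -/
structure State (N : Type u) : Type u where
  table : Table N
  upd : List (Update N)
  code : Code N

/-- Local transitions of node `ι`: the clock reading, the internal and the external updates that are
generated, and the states before and after. Arbitrary code may do anything. -/
inductive LocalStep (cr : Crypto (Val N)) (ι : N) :
    State N → ℕ → List (Update N) → List (Update N) → State N → Prop
  | init (now : ℕ) (P : Program N) :
      LocalStep cr ι ⟨0, [], .prog P⟩ now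
        (P.base.map fun b => .ins ⟨b.1, .node ι :: b.2⟩) []
        ⟨0, P.base.map fun b => .ins ⟨b.1, .node ι :: b.2⟩, .prog P⟩
  | ruleFire (now : ℕ) (P : Program N) (Ψ : Table N) (w : Update N) (U Ui Ue : List (Update N))
      (h : FireRules cr now ι Ψ w (deltas P.rules) Ui Ue) :
      LocalStep cr ι ⟨Ψ, w :: U, .prog P⟩ now Ui Ue ⟨applyUpdate Ψ w, U ++ Ui, .prog P⟩
  | anything (now : ℕ) (Ψ Ψ' : Table N) (U U' Ui Ue : List (Update N)) :
      LocalStep cr ι ⟨Ψ, U, .arbitrary⟩ now Ui Ue ⟨Ψ', U', .arbitrary⟩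

/-- A configuration: the network queue and the local states of the nodes. -/
structure Config (N : Type u) : Type u where
  queue : List (Update N)
  st : N → State N

/-- What a node takes from the network: a program takes only its network tuples. -/
def Code.Accepts : Code N → Update N → Prop
  | .prog P, w => P.net w.tuple.pred
  | .arbitrary, _ => True

/-- Labels of global transitions. -/
inductive Action (N : Type u) : Type u where
  | node (i : N) (now : ℕ) (Ui Ue : List (Update N)) : Action N
  | dequeue : Action N

open Classical in
/-- Global transitions. In `dequeue` the list `d` splits the queue, in order, into the part that
stays (`none`) and the parts that are delivered to the nodes (`some j`). -/
inductive Step (cr : Crypto (Val N)) : Config N → Action N → Config N → Prop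
  | nodeStep (Q : List (Update N)) (st st' : N → State N) (i : N) (now : ℕ)
      (Ui Ue : List (Update N)) (h : LocalStep cr i (st i) now Ui Ue (st' i))
      (hne : ∀ j, j ≠ i → st' j = st j) :
      Step cr ⟨Q, st⟩ (.node i now Ui Ue) ⟨Q ++ Ue, st'⟩
  | dequeue (d : List (Option N × Update N)) (st : N → State N)
      (hd : ∀ j w, (some j, w) ∈ d → w.tuple.At j ∧ (st j).code.Accepts w) :
      Step cr ⟨d.map Prod.snd, st⟩ .dequeue
        ⟨(d.filter fun x => x.1 = none).map Prod.snd,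
          fun j => { st j with
            upd := (st j).upd ++ (d.filter fun x => x.1 = some j).map Prod.snd }⟩

/-- A finite trace whose `k`-th transition (`k < len`) goes from `cfg k` to `cfg (k + 1)` at time
`time k`. -/
structure Trace (cr : Crypto (Val N)) (T : Type v) [LinearOrder T] where
  len : ℕ
  cfg : ℕ → Config N
  act : ℕ → Action N
  time : ℕ → T
  step : ∀ k < len, Step cr (cfg k) (act k) (cfg (k + 1))
  mono : ∀ j k, j ≤ k → k < len → time j ≤ time k

variable {cr : Crypto (Val N)} {T : Type v} [LinearOrder T]

/-- `P@(i, τ)`: node `i` has derived the tuple `P` at time `τ` or earlier. -/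
def Trace.Derives (𝒯 : Trace cr T) (P : Tuple N) (i : N) (τ : T) : Prop :=
  ∃ k < 𝒯.len, 𝒯.time k ≤ τ ∧ ∃ now Ui Ue, 𝒯.act k = .node i now Ui Ue ∧
    (.ins P ∈ Ui ∨ .ins P ∈ Ue)

/-- `honest(i, P, τ)`: at time `τ` node `i` is in the initial state of the program `P`. The time `⊥`
(minus infinity) is that of the first configuration of the trace. -/
def Trace.HonestFrom (𝒯 : Trace cr T) (i : N) (P : Program N) (τ : WithBot T) : Prop :=
  ∃ k ≤ 𝒯.len, (∀ j < k, (𝒯.time j : WithBot T) ≤ τ) ∧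
    (∀ j, k ≤ j → j < 𝒯.len → τ < (𝒯.time j : WithBot T)) ∧
    (𝒯.cfg k).st i = ⟨0, [], .prog P⟩

/-- `verifyMac(msg, m, key)@(i, τ)`: at time `τ` node `i` processes a new tuple and uses an instance of
a rule, all of whose body tuples and constraints are satisfied, in which the constraint
`f_verifymac(a, b, c) == 1` occurs with the values `msg`, `m`, `key` of `a`, `b`, `c`. -/
def Trace.VerifyMac (𝒯 : Trace cr T) (msg m key : Val N) (i : N) (τ : T) : Prop :=
  ∃ k < 𝒯.len, 𝒯.time k = τ ∧ ∃ now Ui Ue, 𝒯.act k = .node i now Ui Ue ∧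
    ∃ Ψ q U P, (𝒯.cfg k).st i = ⟨Ψ, .ins q :: U, .prog P⟩ ∧ q ∉ Ψ ∧
      ∃ r ∈ P.rules, ∃ j σ, Rho cr now (applyUpdate Ψ (.ins q)) Ψ r j q σ ∧
        ∃ a b c : Term N, .cmp .eq (.app3 .verifyMac a b c) (.const (.num 1)) ∈ r.atoms ∧
          a.eval cr now σ = msg ∧ b.eval cr now σ = m ∧ c.eval cr now σ = key

end Semantics

/-! ### The SCION program -/

section Program

variable {N : Type u}

instance : Coe Var (Term N) := ⟨Term.var⟩

/-- The term for a list `[t₁, …, tₖ]`. -/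
def tlist (ts : List (Term N)) : Term N :=
  ts.foldr (fun t l => .app2 .prepend t l) (.const (.list []))

def tnum (k : ℕ) : Term N := .const (.num k)
def tsize (t : Term N) : Term N := .app1 .size t
def tfirst (t : Term N) : Term N := .app1 .first t
def tlast (t : Term N) : Term N := .app1 .last t
def tcons (t l : Term N) : Term N := .app2 .prepend t l
def tconcat (l l' : Term N) : Term N := .app2 .concat l l'
def tnth (l k : Term N) : Term N := .app2 .nth l k
def ttake (l k : Term N) : Term N := .app2 .take l k
def tadd (j k : Term N) : Term N := .app2 .add j k
def tsub (j k : Term N) : Term N := .app2 .sub j k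
def aeq (s t : Term N) : Atom N := .cmp .eq s t
def alt (s t : Term N) : Atom N := .cmp .lt s t
def lit (p : Pred) (xs : List Var) : Lit N := ⟨p, xs.map Term.var⟩

/-- b1: the TD core generates a signature for the beacon to a customer. -/
def b1 : Rule N where
  head := lit .signature [.N, .Info, .Sig, .Time]
  body := [lit .beaconPrep [.N, .Glb, .SigG, .Time], lit .coreTD [.N, .N, .Td, .Ctf],
    lit .customer [.N, .M, .Ceg], lit .mac [.N, .MInfo, .Mac], lit .privateKeys [.N, .K]]
  atoms := [aeq Var.Glb (tlist [Var.Td, Var.Time]), aeq Var.MInfo (tlist [Var.Ceg]),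
    .assign .Itf (tlist [Var.N, Var.Ceg, Var.M]), .assign .Tl (tlist [Var.Time]),
    .assign .Ol (tlist [tlist [Var.Ceg, Var.Mac]]),
    .assign .Info (tlist [Var.Itf, Var.Tl, Var.Ol, tlist []]),
    .assign .Sig (.app2 .sign Var.Info Var.K)]

/-- b2: the TD core signs the global information of a beacon. -/
def b2 : Rule N where
  head := lit .signature [.N, .Info, .Sig, .Time]
  body := [lit .coreTD [.N, .N, .Td, .Ctf], lit .privateKeys [.N, .K]]
  atoms := [.assign .Time .now, .assign .Info (tlist [Var.Td, Var.Time]),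
    .assign .Sig (.app2 .sign Var.Info Var.K)]

/-- b3: the TD core initiates an opaque field. -/
def b3 : Rule N where
  head := lit .mac [.N, .Info, .Mac]
  body := [lit .coreTD [.N, .N, .Td, .Ctf], lit .customer [.N, .M, .Ceg],
    lit .privateKeys [.N, .K]]
  atoms := [.assign .Info (tlist [Var.Ceg]), .assign .Mac (.app2 .mac Var.Info Var.K)]

/-- b4: the TD core initiates the global information of a beacon. -/
def b4 : Rule N where
  head := lit .beaconPrep [.N, .Glb, .SigG, .Time]
  body := [lit .coreTD [.N, .N, .Td, .Ctf], lit .signature [.N, .Glb, .SigG, .Time]]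
  atoms := [aeq Var.Glb (tlist [Var.Td, Var.Time])]

/-- b5: the TD core sends a new beacon to a customer. -/
def b5 : Rule N where
  head := lit .beaconIni [.M, .N, .Td, .Itf, .Tl, .Ol, .Sl, .SigG]
  body := [lit .beaconPrep [.N, .Glb, .SigG, .Time], lit .coreTD [.N, .N, .Td, .Ctf],
    lit .customer [.N, .M, .Ceg], lit .mac [.N, .MInfo, .Mac],
    lit .signature [.N, .Info, .Sig, .Time]]
  atoms := [aeq Var.Glb (tlist [Var.Td, Var.Time]), aeq Var.MInfo (tlist [Var.Ceg]),
    .assign .Itf (tlist [Var.N, Var.Ceg, Var.M]), .assign .Tl (tlist [Var.Time]),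
    .assign .Ol (tlist [tlist [Var.Ceg, Var.Mac]]),
    aeq Var.Info (tlist [Var.Itf, Var.Tl, Var.Ol, tlist []]),
    .assign .Sl (tlist [Var.Sig])]

/-- b6: an AD receives a beacon from the TD core and attaches its ingress interface. -/
def b6 : Rule N where
  head := lit .beaconRev [.N, .Td, .Ing, .Itf1, .Tl, .Ol, .Sl, .SigG]
  body := [lit .beaconIni [.N, .C, .Td, .Itf, .Tl, .Ol, .Sl, .SigG],
    lit .coreTD [.N, .C, .Td, .Ctf], lit .provider [.N, .C, .Ing]]
  atoms := [aeq Var.Itf (tlist [Var.C, Var.Ceg, Var.N]),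
    aeq Var.Ol (tlist [tlist [Var.Ceg, Var.Mac]]),
    .assign .Itf1 (tconcat Var.Itf (tlist [Var.Ing]))]

/-- b7: an AD receives a beacon from a non-core AD and attaches its ingress interface. -/
def b7 : Rule N where
  head := lit .beaconRev [.N, .Td, .Ing, .Itf1, .Tl, .Ol, .Sl, .SigG]
  body := [lit .beaconFwd [.N, .H, .Td, .Itf, .Tl, .Ol, .Sl, .SigG],
    lit .provider [.N, .H, .Ing]]
  atoms := [aeq Var.Itf (tconcat Var.ItfP (tlist [Var.H, Var.Hig, Var.Heg, Var.N])),
    aeq Var.Ol (tconcat Var.OlP (tlist [tlist [Var.Hig, Var.Heg, Var.Mac]])),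
    .assign .Itf1 (tconcat Var.Itf (tlist [Var.Ing]))]

/-- b8: an AD verifies the global information of a beacon. -/
def b8 : Rule N where
  head := lit .beaconToVeri [.N, .Td, .Itf, .Tl, .Ol, .Sl, .SigG, .Itfv, .Pos]
  body := [lit .beaconRev [.N, .Td, .Ing, .Itf, .Tl, .Ol, .Sl, .SigG],
    lit .coreTD [.N, .C, .Td, .Ctf], lit .publicKeys [.N, .C, .Pk]]
  atoms := [aeq Var.C (tfirst Var.Itf), .assign .Time (tfirst Var.Tl),
    .assign .Glb (tlist [Var.Td, Var.Time]),
    aeq (.app3 .verify Var.Glb Var.SigG Var.Pk) (tnum 1),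
    .assign .Itfv (ttake Var.Itf (tnum 3)), .assign .Pos (tnum 0)]

/-- b9: an AD verifies the signature at position `Pos`. The prefix `Itfv` of the interface field is the
one covered by that signature, three entries long for the signature of the TD core (the first entry),
three more for each further signer, who is then the fourth entry from the end. -/
def b9 : Rule N where
  head := lit .beaconToVeri [.N, .Td, .Itf, .Tl, .Ol, .Sl, .SigG, .Itfv1, .Pos1]
  body := [lit .beaconToVeri [.N, .Td, .Itf, .Tl, .Ol, .Sl, .SigG, .Itfv, .Pos],
    lit .publicKeys [.N, .Nd, .Pk]]
  atoms := [alt Var.Pos (tsize Var.Sl),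
    aeq Var.Nd (tnth Var.Itfv (tsub (tsize Var.Itfv) (tnum 4))),
    .assign .Sig (tnth Var.Sl Var.Pos), .assign .Pos1 (tadd Var.Pos (tnum 1)),
    .assign .Info (tlist [Var.Itfv, ttake Var.Tl Var.Pos1, ttake Var.Ol Var.Pos1,
      ttake Var.Sl Var.Pos]),
    aeq (.app3 .verify Var.Info Var.Sig Var.Pk) (tnum 1),
    .assign .Itfv1 (ttake Var.Itf (tadd (tsize Var.Itfv) (tnum 3)))]

/-- b10: an AD validates a beacon, all of whose signatures have been verified. -/
def b10 : Rule N where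
  head := lit .verifiedBeacon [.N, .Td, .Itf, .Tl, .Ol, .Sl, .SigG]
  body := [lit .beaconToVeri [.N, .Td, .Itf, .Tl, .Ol, .Sl, .SigG, .Itfv, .Pos]]
  atoms := [aeq Var.Pos (tsize Var.Sl), aeq (tsize Var.Ol) (tsize Var.Sl),
    aeq (tsize Var.Tl) (tsize Var.Sl),
    aeq (tsize Var.Itf)
      (tadd (tsize Var.Sl) (tadd (tsize Var.Sl) (tadd (tsize Var.Sl) (tnum 1))))]

/-- b11: an AD creates a signature for a new beacon, to a customer. -/
def b11 : Rule N where
  head := lit .signature [.N, .Info, .Sig, .Time]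
  body := [lit .verifiedBeacon [.N, .Td, .Itf, .Tl, .Ol, .Sl, .SigG],
    lit .customer [.N, .M, .Neg], lit .mac [.N, .MInfo, .Mac], lit .privateKeys [.N, .K]]
  atoms := [.assign .Nig (tlast Var.Itf),
    aeq Var.MInfo (tcons Var.Nig (tcons Var.Neg (tlast Var.Ol))),
    .assign .Time .now, .assign .Itf1 (tconcat Var.Itf (tlist [Var.Neg, Var.M])),
    .assign .Tl1 (tconcat Var.Tl (tlist [Var.Time])),
    .assign .Ol1 (tconcat Var.Ol (tlist [tlist [Var.Nig, Var.Neg, Var.Mac]])),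
    .assign .Info (tlist [Var.Itf1, Var.Tl1, Var.Ol1, Var.Sl]),
    .assign .Sig (.app2 .sign Var.Info Var.K)]

/-- b12: an AD initiates the opaque field for a new beacon. The MAC covers the ingress and the egress
interface of the AD and the opaque field of its provider. -/
def b12 : Rule N where
  head := lit .mac [.N, .Info, .Mac]
  body := [lit .verifiedBeacon [.N, .Td, .Itf, .Tl, .Ol, .Sl, .SigG],
    lit .customer [.N, .M, .Neg], lit .privateKeys [.N, .K]]
  atoms := [.assign .Nig (tlast Var.Itf),
    .assign .Info (tcons Var.Nig (tcons Var.Neg (tlast Var.Ol))),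
    .assign .Mac (.app2 .mac Var.Info Var.K)]

/-- b13: an AD sends the new beacon to a customer. -/
def b13 : Rule N where
  head := lit .beaconFwd [.M, .N, .Td, .Itf1, .Tl1, .Ol1, .Sl1, .SigG]
  body := [lit .verifiedBeacon [.N, .Td, .Itf, .Tl, .Ol, .Sl, .SigG],
    lit .customer [.N, .M, .Neg], lit .mac [.N, .MInfo, .Mac],
    lit .signature [.N, .Info, .Sig, .Time]]
  atoms := [.assign .Nig (tlast Var.Itf),
    aeq Var.MInfo (tcons Var.Nig (tcons Var.Neg (tlast Var.Ol))),
    .assign .Itf1 (tconcat Var.Itf (tlist [Var.Neg, Var.M])),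
    .assign .Tl1 (tconcat Var.Tl (tlist [Var.Time])),
    .assign .Ol1 (tconcat Var.Ol (tlist [tlist [Var.Nig, Var.Neg, Var.Mac]])),
    aeq Var.Info (tlist [Var.Itf1, Var.Tl1, Var.Ol1, Var.Sl]),
    .assign .Sl1 (tconcat Var.Sl (tlist [Var.Sig]))]

/-- pc1: an AD extracts path information; the up path lists the opaque fields from the provider of the
AD to the TD core. -/
def pc1 : Rule N where
  head := lit .upPath [.N, .Td, .Itf, .OpqU, .Tl]
  body := [lit .verifiedBeacon [.N, .Td, .Itf, .Tl, .Ol, .Sl, .SigG]]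
  atoms := [.assign .OpqU (.app1 .reverse Var.Ol)]

/-- pc2: an AD initiates the upload of a path. -/
def pc2 : Rule N where
  head := lit .pathUpload [.M, .N, .Src, .Core, .Itf, .OpqD, .OpqU, .Pt]
  body := [lit .upPath [.N, .Td, .Itf, .OpqU, .Tl], lit .coreTD [.N, .Core, .Td, .Ctf],
    lit .provider [.N, .M, .Ing]]
  atoms := [aeq Var.Ing (tlast Var.Itf), .assign .Src Var.N,
    .assign .OpqD (.app1 .reverse Var.OpqU), .assign .Pt (tnum 0)]

/-- pc3: an AD checks the MAC of its opaque field, the one at position `Pt`, and sends the path to the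
provider at its ingress interface. -/
def pc3 : Rule N where
  head := lit .pathUpload [.M, .N, .Src, .Core, .Itf, .OpqD, .OpqU, .Pt1]
  body := [lit .pathUpload [.N, .Nb, .Src, .Core, .Itf, .OpqD, .OpqU, .Pt],
    lit .privateKeys [.N, .K], lit .provider [.N, .M, .Nig]]
  atoms := [aeq (.app1 .wfOpq Var.OpqU) (tnum 1),
    .assign .Pt1 (tadd Var.Pt (tnum 1)), alt Var.Pt1 (tsize Var.OpqU),
    aeq (tnth Var.OpqU Var.Pt) (tlist [Var.Nig, Var.Neg, Var.Mac]),
    .assign .Info (tcons Var.Nig (tcons Var.Neg (tnth Var.OpqU Var.Pt1))),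
    aeq (.app3 .verifyMac Var.Info Var.Mac Var.K) (tnum 1)]

/-- pc4: the TD core checks the MAC of its opaque field, the last one, and stores the path. -/
def pc4 : Rule N where
  head := lit .downPath [.N, .Src, .Itf, .OpqD]
  body := [lit .pathUpload [.N, .Nb, .Src, .N, .Itf, .OpqD, .OpqU, .Pt],
    lit .coreTD [.N, .N, .Td, .Ctf], lit .privateKeys [.N, .K]]
  atoms := [aeq (.app1 .wfOpq Var.OpqU) (tnum 1),
    aeq (tsize Var.OpqU) (tadd Var.Pt (tnum 1)),
    aeq (tnth Var.OpqU Var.Pt) (tlist [Var.Ceg, Var.Mac]),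
    .assign .Info (tlist [Var.Ceg]),
    aeq (.app3 .verifyMac Var.Info Var.Mac Var.K) (tnum 1)]

/-- The base tuples of a node (the location specifier is left out): the topology around it, its keys,
and the certified cores it knows. -/
inductive BaseFact (N : Type u) : Type u where
  | coreTD (c : N) (td ctf : Val N) : BaseFact N
  | provider (m : N) (ig : Val N) : BaseFact N
  | customer (m : N) (eg : Val N) : BaseFact N
  | privateKeys (k : Val N) : BaseFact N
  | publicKeys (m : N) (k : Val N) : BaseFact N

def BaseFact.toBase : BaseFact N → Pred × List (Val N)
  | .coreTD c td ctf => (.coreTD, [.node c, td, ctf])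
  | .provider m ig => (.provider, [.node m, ig])
  | .customer m eg => (.customer, [.node m, eg])
  | .privateKeys k => (.privateKeys, [k])
  | .publicKeys m k => (.publicKeys, [.node m, k])

/-- The SCION program of a node with the given base tuples. Beacons and path uploads are received from
the network; everything else is local. -/
def scionProg (base : List (BaseFact N)) : Program N where
  base := base.map BaseFact.toBase
  rules := [b1, b2, b3, b4, b5, b6, b7, b8, b9, b10, b11, b12, b13, pc1, pc2, pc3, pc4]
  net := fun p => p = .beaconIni ∨ p = .beaconFwd ∨ p = .pathUpload

end Program

/-! ### Honest nodes, the MAC axiom, and good forwarding paths -/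

section Property

variable {N : Type u} {cr : Crypto (Val N)} {T : Type v} [LinearOrder T]

/-- `Honest(n)`: node `n` runs the SCION program, with its base tuples, from time minus infinity. -/
def Honest (base : N → List (BaseFact N)) (𝒯 : Trace cr T) (n : N) : Prop :=
  𝒯.HonestFrom n (scionProg (base n)) ⊥

/-- The MAC axiom: if an honest node verifies a MAC with its own private key, then it has itself
generated that MAC before. -/
def MacAxiom (base : N → List (BaseFact N)) (𝒯 : Trace cr T) : Prop :=
  ∀ (msg m k : Val N) (n : N) (t : T),
    𝒯.VerifyMac msg m k n t → 𝒯.Derives ⟨.privateKeys, [.node n, k]⟩ n t → Honest base 𝒯 n →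
      ∃ t' < t, 𝒯.Derives ⟨.mac, [.node n, msg, m]⟩ n t'

/-- `goodFwdPath(t, n, opqU, pt)`; the opaque field checked by `n` is the one before position `pt`. -/
inductive GoodFwdPath (base : N → List (BaseFact N)) (𝒯 : Trace cr T) (t : T) (n : N) :
    Val N → Val N → Prop
  | unchecked (opqU : Val N) : GoodFwdPath base 𝒯 t n opqU (.num 0)
  | core (opq' : List (Val N)) (ceg mac : Val N)
      (h : Honest base 𝒯 n → ∃ t' ≤ t, ∃ (m : N) (td ctf : Val N),
        𝒯.Derives ⟨.coreTD, [.node n, .node n, td, ctf]⟩ n t' ∧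
        𝒯.Derives ⟨.customer, [.node n, .node m, ceg]⟩ n t') :
      GoodFwdPath base 𝒯 t n (Val.list (opq' ++ [Val.list [ceg, mac]]))
        (.num (opq' ++ [Val.list [ceg, mac]]).length)
  | belowCore (opq' : List (Val N)) (nig neg mac' ceg mac : Val N) (pt : ℕ)
      (hpos : 0 < pt) (hlt : pt < (opq' ++ [Val.list [nig, neg, mac'], Val.list [ceg, mac]]).length)
      (hpt : pt = opq'.length + 1)
      (h : Honest base 𝒯 n → ∃ t' ≤ t, ∃ h m : N,
        𝒯.Derives ⟨.provider, [.node n, .node h, nig]⟩ n t' ∧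
        𝒯.Derives ⟨.customer, [.node n, .node m, neg]⟩ n t' ∧
        ∃ td' tl sl sg : Val N,
          𝒯.Derives ⟨.verifiedBeacon, [.node n, td', Val.list [.node h, ceg, .node n, nig], tl,
            Val.list [Val.list [ceg, mac]], sl, sg]⟩ n t') :
      GoodFwdPath base 𝒯 t n
        (Val.list (opq' ++ [Val.list [nig, neg, mac'], Val.list [ceg, mac]])) (.num pt)
  | inner (opq' opq'' : List (Val N)) (nig neg mac' hig heg mac : Val N) (pt : ℕ)
      (hpos : 0 < pt)
      (hlt : pt < (opq' ++ [Val.list [nig, neg, mac'], Val.list [hig, heg, mac]] ++ opq'').length)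
      (hpt : pt = opq'.length + 1)
      (h : Honest base 𝒯 n → ∃ t' ≤ t, ∃ h m : N,
        𝒯.Derives ⟨.provider, [.node n, .node h, nig]⟩ n t' ∧
        𝒯.Derives ⟨.customer, [.node n, .node m, neg]⟩ n t' ∧
        ∃ (td' tl sl sg : Val N) (p' p'' : List (Val N)),
          𝒯.Derives ⟨.verifiedBeacon, [.node n, td',
            .list (p' ++ [.node h, hig, heg, .node n, nig]), tl,
            .list (p'' ++ [Val.list [hig, heg, mac]]), sl, sg]⟩ n t') :
      GoodFwdPath base 𝒯 t n
        (Val.list (opq' ++ [Val.list [nig, neg, mac'], Val.list [hig, heg, mac]] ++ opq'')) (.num pt)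

end Property

end Scion

/-! The argument is provenance at one honest node, with the MAC axiom as a bridge from a verified
MAC back to the rule that created it. Such a node starts empty, keeps its program, and takes only
network names from outside. Hence every other tuple it holds was generated by the node itself in an
earlier transition, and every insertion it generates is a base tuple or a rule instance whose local
body tuples have this property (`Trace.HonestFrom.generates_cases`). Facts about the node are then
obtained by reading the rules backwards.

An upload sent by the node comes from pc2, with position 0, or from pc3 (`generates_pathUpload`). In
the latter case the node has verified, under its own key, a MAC of its two interfaces followed by
the next opaque field. By the axiom it generated that MAC earlier. A message with at least two
entries can only come from b12 (`generates_mac`), which supplies the customer tuple and a verified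
beacon with that opaque field last and that ingress interface last. Following the beacon back
through b10, b9 and b8 to b6 or b7 gives the provider and the end of the interface list
(`generates_verifiedBeacon`): these are checked on receipt, so an arbitrary sender does no harm.

It remains to match two descriptions of the same field. Well-formedness makes the next field a final
pair or a triple, and the beacon ends in a pair (from the core) or a triple. Lengths exclude the
mixed cases; the other two are `belowCore` and `inner`. The case `core` never arises, since pc3
keeps the new position below the length of the path. -/

namespace Scion

/-! ### Provenance of tuples at a node that runs a program from the empty state. -/

section Generic

variable {N : Type*} {cr : Crypto (Val N)} {T : Type*} [LinearOrder T]

theorem Rho.inst_mem {now : ℕ} {Ψ : Table N} {r : Rule N} {i : ℕ} {q : Tuple N}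
    {σ : Var → Val N} (h : Rho cr now (applyUpdate Ψ (.ins q)) Ψ r i q σ)
    {p : Lit N} (hp : p ∈ r.body) : p.inst cr now σ = q ∨ p.inst cr now σ ∈ Ψ := by
  obtain ⟨⟨p', hp', hq⟩, h1, h2, -⟩ := h
  obtain ⟨j, hj⟩ := List.mem_iff_getElem?.1 hp
  rcases lt_trichotomy j i with hji | rfl | hij
  · simpa [applyUpdate] using h1 j p hji hj
  · rw [hp'] at hj
    cases hj
    exact .inl hq
  · exact .inr (h2 j p hij hj)

theorem mem_applyUpdate {Ψ : Table N} {w : Update N} {p : Tuple N}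
    (h : p ∈ applyUpdate Ψ w) : p ∈ Ψ ∨ w = .ins p := by
  classical
  cases w with
  | ins q =>
    rcases Multiset.mem_cons.1 h with rfl | h
    · exact .inr rfl
    · exact .inl h
  | del q => exact .inl (Multiset.mem_of_mem_erase h)

theorem mem_deltas {rs : List (Rule N)} {r : Rule N} {i : ℕ} (h : (r, i) ∈ deltas rs) :
    r ∈ rs := by
  simp only [deltas, List.mem_flatMap, List.mem_map, Prod.mk.injEq] at h
  obtain ⟨r', hr', -, -, rfl, -⟩ := h
  exact hr'

/-- An insertion generated by a `Δ` rule comes from a substitution in `ρ` for a new tuple. -/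
theorem FireSingle.exists_rho {now : ℕ} {ι : N} {Ψ : Table N} {w : Update N} {r : Rule N} {i : ℕ}
    {Ui Ue : List (Update N)} (h : FireSingle cr now ι Ψ w r i Ui Ue) {p : Tuple N}
    (hp : .ins p ∈ Ui ∨ .ins p ∈ Ue) :
    ∃ q σ, w = .ins q ∧ q ∉ Ψ ∧ Rho cr now (applyUpdate Ψ (.ins q)) Ψ r i q σ ∧
      p = r.head.inst cr now σ := by
  cases h with
  | insNew q _ _ hq U hU =>
    have hm : Update.ins p ∈ U := by
      rcases hp with hp | hp <;> exact List.mem_of_mem_filter hp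
    rcases hU _ hm with ⟨σ, hσ, he⟩ | ⟨_, -, -, he⟩
    · cases he
      exact ⟨q, σ, rfl, hq, hσ, rfl⟩
    · cases he
  | delNew q _ _ _ U hU =>
    have hm : Update.ins p ∈ U := by
      rcases hp with hp | hp <;> exact List.mem_of_mem_filter hp
    obtain ⟨_, -, he⟩ := hU _ hm
    cases he
  | _ => simp at hp

theorem FireRules.exists_rho {now : ℕ} {ι : N} {Ψ : Table N} {w : Update N}
    {ds : List (Rule N × ℕ)} {Ui Ue : List (Update N)} (h : FireRules cr now ι Ψ w ds Ui Ue)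
    {p : Tuple N} (hp : .ins p ∈ Ui ∨ .ins p ∈ Ue) :
    ∃ r i q σ, (r, i) ∈ ds ∧ w = .ins q ∧ q ∉ Ψ ∧
      Rho cr now (applyUpdate Ψ (.ins q)) Ψ r i q σ ∧ p = r.head.inst cr now σ := by
  induction h with
  | empty => simp at hp
  | seq r i ds Ui Ue Ui' Ue' h h' ih =>
    simp only [List.mem_append] at hp
    by_cases hs : .ins p ∈ Ui ∨ .ins p ∈ Ue
    · obtain ⟨q, σ, hq⟩ := h.exists_rho hs
      exact ⟨r, i, q, σ, by simp, hq⟩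
    · obtain ⟨r', i', q, σ, hr, hq⟩ := ih (by tauto)
      exact ⟨r', i', q, σ, by simp [hr], hq⟩

/-- The tuple is stored at a node or waits there to be inserted. -/
def State.Holds (s : State N) (p : Tuple N) : Prop := p ∈ s.table ∨ .ins p ∈ s.upd

theorem LocalStep.code_eq {ι : N} {s s' : State N} {now : ℕ} {Ui Ue : List (Update N)}
    (h : LocalStep cr ι s now Ui Ue s') : s'.code = s.code := by
  cases h <;> rfl

/-- Processing an insertion moves its tuple from the update list to the table. As `State.Holds`
covers both places, a tuple newly held must be among the generated internal updates. -/
theorem LocalStep.holds {ι : N} {s s' : State N} {now : ℕ} {Ui Ue : List (Update N)}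
    {P : Program N} (h : LocalStep cr ι s now Ui Ue s') (hs : s.code = .prog P) {p : Tuple N}
    (hp : s'.Holds p) : s.Holds p ∨ .ins p ∈ Ui := by
  cases h with
  | init now P => simpa [State.Holds] using hp
  | ruleFire now P Ψ w U Ui Ue h =>
    rcases hp with hp | hp
    · rcases mem_applyUpdate hp with hp | rfl
      · exact .inl (.inl hp)
      · exact .inl (.inr (by simp))
    · rcases List.mem_append.1 hp with hp | hp
      · exact .inl (.inr (by simp [hp]))
      · exact .inr hp
  | anything => cases hs

theorem LocalStep.exists_rho {ι : N} {s s' : State N} {now : ℕ} {Ui Ue : List (Update N)}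
    {P : Program N} (h : LocalStep cr ι s now Ui Ue s') (hs : s.code = .prog P) {p : Tuple N}
    (hp : .ins p ∈ Ui ∨ .ins p ∈ Ue) :
    (∃ b ∈ P.base, p = ⟨b.1, .node ι :: b.2⟩) ∨
      ∃ Ψ q U, s = ⟨Ψ, .ins q :: U, .prog P⟩ ∧ q ∉ Ψ ∧ ∃ r ∈ P.rules, ∃ i σ,
        Rho cr now (applyUpdate Ψ (.ins q)) Ψ r i q σ ∧ p = r.head.inst cr now σ := by
  cases h with
  | init now P' =>
    cases hs
    left
    simp only [List.mem_map, Update.ins.injEq, List.not_mem_nil, or_false] at hp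
    obtain ⟨b, hb, rfl⟩ := hp
    exact ⟨b, hb, rfl⟩
  | ruleFire now P' Ψ w U Ui Ue h =>
    cases hs
    obtain ⟨r, i, q, σ, hr, rfl, hq, hσ, he⟩ := h.exists_rho hp
    exact .inr ⟨Ψ, q, U, rfl, hq, r, mem_deltas hr, i, σ, hσ, he⟩
  | anything => cases hs

theorem Step.localStep {c c' : Config N} {i : N} {now : ℕ} {Ui Ue : List (Update N)}
    (h : Step cr c (.node i now Ui Ue) c') : LocalStep cr i (c.st i) now Ui Ue (c'.st i) := by
  cases h with
  | nodeStep _ _ _ _ _ _ _ h _ => exact h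

theorem Step.code_eq {c c' : Config N} {a : Action N} (h : Step cr c a c') (n : N) :
    (c'.st n).code = (c.st n).code := by
  cases h with
  | nodeStep Q st st' i now Ui Ue h hne =>
    by_cases hn : n = i
    · subst hn
      exact h.code_eq
    · exact congrArg _ (hne n hn)
  | dequeue => rfl

/-- Steps of other nodes leave the state of `n` alone, and delivery is filtered by `Code.Accepts`.
So a tuple with a local name can enter only through a step of `n` itself, however malicious the rest
of the network is. -/
theorem Step.holds {c c' : Config N} {a : Action N} (h : Step cr c a c') {n : N} {P : Program N}
    (hn : (c.st n).code = .prog P) {p : Tuple N} (hp : (c'.st n).Holds p)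
    (hnet : ¬ P.net p.pred) :
    (c.st n).Holds p ∨ ∃ now Ui Ue, a = .node n now Ui Ue ∧ .ins p ∈ Ui := by
  cases h with
  | nodeStep Q st st' i now Ui Ue h hne =>
    by_cases hi : n = i
    · subst hi
      rcases h.holds hn hp with hp | hp
      · exact .inl hp
      · exact .inr ⟨now, Ui, Ue, rfl, hp⟩
    · left
      have hst : st' n = st n := hne n hi
      change (st n).Holds p
      rw [← hst]
      exact hp
  | dequeue d st hd =>
    left
    rcases hp with hp | hp
    · exact .inl hp
    · rcases List.mem_append.1 hp with hp | hp
      · exact .inr hp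
      · exfalso
        simp only [List.mem_map, List.mem_filter, decide_eq_true_eq] at hp
        obtain ⟨⟨o, w⟩, ⟨hm, rfl⟩, rfl⟩ := hp
        have hacc := (hd n _ hm).2
        rw [show (st n).code = .prog P from hn] at hacc
        exact hnet hacc

/-- Node `n` generates the insertion of `p` in the `k`-th transition. -/
def Trace.Generates (𝒯 : Trace cr T) (p : Tuple N) (n : N) (k : ℕ) : Prop :=
  ∃ now Ui Ue, 𝒯.act k = .node n now Ui Ue ∧ (.ins p ∈ Ui ∨ .ins p ∈ Ue)

/-- No time stamp lies at or below `⊥`, so no transition can precede the configuration in which the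
node is initial. -/
theorem Trace.HonestFrom.initial {𝒯 : Trace cr T} {n : N} {P : Program N}
    (h : 𝒯.HonestFrom n P ⊥) : (𝒯.cfg 0).st n = ⟨0, [], .prog P⟩ := by
  obtain ⟨k, -, hk, -, hs⟩ := h
  cases k with
  | zero => exact hs
  | succ k => exact absurd (hk 0 k.succ_pos) (by simp)

variable {𝒯 : Trace cr T} {n : N} {P : Program N}

theorem Trace.HonestFrom.code_eq (h : 𝒯.HonestFrom n P ⊥) {k : ℕ} (hk : k ≤ 𝒯.len) :
    ((𝒯.cfg k).st n).code = .prog P := by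
  induction k with
  | zero => rw [h.initial]
  | succ k ih => rw [(𝒯.step k hk).code_eq n, ih (by omega)]

/-- The initial state holds nothing, so the tuple entered at some step before configuration `k`. The
strict inequality makes induction on transition indices possible. -/
theorem Trace.HonestFrom.generates_of_holds (h : 𝒯.HonestFrom n P ⊥) {k : ℕ} (hk : k ≤ 𝒯.len)
    {p : Tuple N} (hp : ((𝒯.cfg k).st n).Holds p) (hnet : ¬ P.net p.pred) :
    ∃ j < k, 𝒯.Generates p n j := by
  induction k with
  | zero => simp [h.initial, State.Holds] at hp
  | succ k ih =>
    rcases (𝒯.step k hk).holds (h.code_eq (by omega)) hp hnet with hp | ⟨now, Ui, Ue, ha, hp⟩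
    · obtain ⟨j, hj, hg⟩ := ih (by omega) hp
      exact ⟨j, by omega, hg⟩
    · exact ⟨k, by omega, now, Ui, Ue, ha, .inl hp⟩

/-- A tuple generated by an honest node is a base tuple or the head of a rule instance whose local
body tuples have been generated before. -/
theorem Trace.HonestFrom.generates_cases (h : 𝒯.HonestFrom n P ⊥) {k : ℕ} (hk : k < 𝒯.len)
    {p : Tuple N} (hp : 𝒯.Generates p n k) :
    (∃ b ∈ P.base, p = ⟨b.1, .node n :: b.2⟩) ∨
      ∃ r ∈ P.rules, ∃ now σ, p = r.head.inst cr now σ ∧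
        (∀ b ∈ r.body, ¬ P.net b.pred → ∃ j < k, 𝒯.Generates (b.inst cr now σ) n j) ∧
        (∀ a ∈ r.atoms, a.Holds cr now σ) ∧
        ∀ a b c, .cmp .eq (.app3 .verifyMac a b c) (.const (.num 1)) ∈ r.atoms →
          𝒯.VerifyMac (a.eval cr now σ) (b.eval cr now σ) (c.eval cr now σ) n (𝒯.time k) := by
  obtain ⟨now, Ui, Ue, ha, hp⟩ := hp
  have hstep := 𝒯.step k hk
  rw [ha] at hstep
  rcases hstep.localStep.exists_rho (h.code_eq hk.le) hp with
    hb | ⟨Ψ, q, U, hs, hq, r, hr, i, σ, hσ, he⟩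
  · exact .inl hb
  · refine .inr ⟨r, hr, now, σ, he, fun b hb hnet => ?_, hσ.2.2.2, fun a b c hat => ?_⟩
    · refine h.generates_of_holds hk.le ?_ hnet
      rw [hs]
      -- The tuple being processed is not in the table, but it still heads the update list of
      -- configuration `k`, so it counts as held.
      rcases hσ.inst_mem hb with hm | hm
      · exact .inr (by simp [hm])
      · exact .inl hm
    · exact ⟨k, hk, rfl, now, Ui, Ue, ha, Ψ, q, U, P, hs, hq, r, hr, i, σ, hσ, a, b, c, hat,
        rfl, rfl, rfl⟩

end Generic


/-! ### Reading the SCION rules backwards. -/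

section ScionRules

variable {N : Type*} {cr : Crypto (Val N)} {T : Type*} [LinearOrder T] {𝒯 : Trace cr T} {n : N}
  {bs : List (BaseFact N)} {k : ℕ}

theorem Val.elems_list (l : List (Val N)) : (Val.list l).elems = l := rfl

/-- The ways in which `scionProg` generates a tuple with a given name. -/
theorem generates_scion_cases (h : 𝒯.HonestFrom n (scionProg bs) ⊥) (hk : k < 𝒯.len)
    {p : Tuple N} (hp : 𝒯.Generates p n k) :
    (∃ b ∈ bs, p = ⟨b.toBase.1, .node n :: b.toBase.2⟩) ∨
      ∃ r ∈ (scionProg bs).rules, r.head.pred = p.pred ∧ ∃ now σ,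
        p.args = (r.head.inst cr now σ).args ∧
        (∀ b ∈ r.body, b.pred ≠ .beaconIni → b.pred ≠ .beaconFwd → b.pred ≠ .pathUpload →
          ∃ j < k, 𝒯.Generates (b.inst cr now σ) n j) ∧
        (∀ a ∈ r.atoms, a.Holds cr now σ) ∧
        ∀ a b c, .cmp .eq (.app3 .verifyMac a b c) (.const (.num 1)) ∈ r.atoms →
          𝒯.VerifyMac (a.eval cr now σ) (b.eval cr now σ) (c.eval cr now σ) n (𝒯.time k) := by
  rcases h.generates_cases hk hp with ⟨b, hb, he⟩ | ⟨r, hr, now, σ, rfl, hbody, hat⟩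
  · obtain ⟨b', hb', rfl⟩ := List.mem_map.1 hb
    exact .inl ⟨b', hb', he⟩
  · exact .inr ⟨r, hr, rfl, now, σ, rfl,
      fun b hb h1 h2 h3 => hbody b hb (by simp [scionProg, h1, h2, h3]), hat⟩

/-- No rule has a head with this name, so the tuple is a base tuple, whose neighbour is a node. This
matters because a substitution may assign any value to a variable, whereas `GoodFwdPath` asks for
nodes. -/
theorem generates_provider (h : 𝒯.HonestFrom n (scionProg bs) ⊥) (hk : k < 𝒯.len)
    {x m ig : Val N} (hp : 𝒯.Generates ⟨.provider, [x, m, ig]⟩ n k) : ∃ m', m = .node m' := by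
  rcases generates_scion_cases h hk hp with ⟨b, -, he⟩ | ⟨r, hr, hpred, -⟩
  · cases b <;> simp [BaseFact.toBase] at he
    exact ⟨_, he.2.1⟩
  · simp only [scionProg, List.mem_cons, List.not_mem_nil, or_false] at hr
    rcases hr with rfl | rfl | rfl | rfl | rfl | rfl | rfl | rfl | rfl | rfl | rfl | rfl | rfl |
      rfl | rfl | rfl | rfl <;> cases hpred

theorem generates_customer (h : 𝒯.HonestFrom n (scionProg bs) ⊥) (hk : k < 𝒯.len)
    {x m eg : Val N} (hp : 𝒯.Generates ⟨.customer, [x, m, eg]⟩ n k) : ∃ m', m = .node m' := by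
  rcases generates_scion_cases h hk hp with ⟨b, -, he⟩ | ⟨r, hr, hpred, -⟩
  · cases b <;> simp [BaseFact.toBase] at he
    exact ⟨_, he.2.1⟩
  · simp only [scionProg, List.mem_cons, List.not_mem_nil, or_false] at hr
    rcases hr with rfl | rfl | rfl | rfl | rfl | rfl | rfl | rfl | rfl | rfl | rfl | rfl | rfl |
      rfl | rfl | rfl | rfl <;> cases hpred

/-- The interface and opaque fields of a beacon received by node `n` from its provider `h`, through
the interface `ing`: `h` is the core (one opaque field, a pair) or not (the last one is a triple). -/
def BeaconShape (𝒯 : Trace cr T) (n : N) (k : ℕ) (itf ol : Val N) : Prop :=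
  ∃ (h : N) (ing : Val N), (∃ j < k, 𝒯.Generates ⟨.provider, [.node n, .node h, ing]⟩ n j) ∧
    ((∃ ceg mac, itf = .list [.node h, ceg, .node n, ing] ∧ ol = .list [.list [ceg, mac]]) ∨
      ∃ p' p'' hig heg mac, itf = .list (p' ++ [.node h, hig, heg, .node n, ing]) ∧
        ol = .list (p'' ++ [.list [hig, heg, mac]]))

theorem BeaconShape.mono {j k : ℕ} {itf ol : Val N} (hjk : j ≤ k) (h : BeaconShape 𝒯 n j itf ol) :
    BeaconShape 𝒯 n k itf ol := by
  obtain ⟨c, ing, ⟨i, hi, hg⟩, h⟩ := h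
  exact ⟨c, ing, ⟨i, by omega, hg⟩, h⟩

/-- Nothing is known about a beacon taken from the network. The shape comes from the equations that
b6 and b7 impose, the ingress interface that they append, and the local provider tuple in their
bodies. -/
theorem generates_beaconRev (h : 𝒯.HonestFrom n (scionProg bs) ⊥) (hk : k < 𝒯.len)
    {td ing itf tl ol sl sg : Val N}
    (hp : 𝒯.Generates ⟨.beaconRev, [.node n, td, ing, itf, tl, ol, sl, sg]⟩ n k) :
    BeaconShape 𝒯 n k itf ol := by
  rcases generates_scion_cases h hk hp with ⟨b, -, he⟩ | ⟨r, hr, hpred, now, σ, he, hbody, hat, -⟩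
  · cases b <;> simp [BaseFact.toBase] at he
  · simp only [scionProg, List.mem_cons, List.not_mem_nil, or_false] at hr
    rcases hr with rfl | rfl | rfl | rfl | rfl | rfl | rfl | rfl | rfl | rfl | rfl | rfl | rfl |
      rfl | rfl | rfl | rfl <;> try cases hpred
    · simp only [b6, lit, Lit.inst, List.map_cons, List.map_nil, Term.eval, List.cons.injEq,
        and_true] at he
      simp only [b6, aeq, tlist, tconcat, List.mem_cons, List.not_mem_nil, or_false,
        forall_eq_or_imp, forall_eq, Atom.Holds, List.foldr, Term.eval, Fn2.eval, Val.elems_list]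
        at hat
      obtain ⟨hN, -, rfl, rfl, -, rfl, -, -⟩ := he
      obtain ⟨hitf, hol, hitf1⟩ := hat
      obtain ⟨j, hj, hg⟩ := hbody (lit .provider [.N, .C, .Ing]) (by simp [b6])
        (by simp [lit]) (by simp [lit]) (by simp [lit])
      simp only [lit, Lit.inst, List.map_cons, List.map_nil, Term.eval, ← hN] at hg
      obtain ⟨c, hc⟩ := generates_provider h (hj.trans hk) hg
      rw [hc] at hg hitf
      refine ⟨c, σ .Ing, ⟨j, hj, hg⟩, .inl ⟨σ .Ceg, σ .Mac, ?_, hol⟩⟩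
      rw [hitf1, hitf, ← hN]
      rfl
    · simp only [b7, lit, Lit.inst, List.map_cons, List.map_nil, Term.eval, List.cons.injEq,
        and_true] at he
      simp only [b7, aeq, tlist, tconcat, List.mem_cons, List.not_mem_nil, or_false,
        forall_eq_or_imp, forall_eq, Atom.Holds, List.foldr, Term.eval, Fn2.eval, Val.elems_list]
        at hat
      obtain ⟨hN, -, rfl, rfl, -, rfl, -, -⟩ := he
      obtain ⟨hitf, hol, hitf1⟩ := hat
      obtain ⟨j, hj, hg⟩ := hbody (lit .provider [.N, .H, .Ing]) (by simp [b7])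
        (by simp [lit]) (by simp [lit]) (by simp [lit])
      simp only [lit, Lit.inst, List.map_cons, List.map_nil, Term.eval, ← hN] at hg
      obtain ⟨c, hc⟩ := generates_provider h (hj.trans hk) hg
      rw [hc] at hg hitf
      -- The prefixes need not be list values: `concat` sees only their `elems`, which therefore
      -- serve as witnesses.
      refine ⟨c, σ .Ing, ⟨j, hj, hg⟩, .inr ⟨(σ .ItfP).elems, (σ .OlP).elems, σ .Hig, σ .Heg, σ .Mac,
        ?_, hol⟩⟩
      rw [hitf1, hitf, ← hN]
      simp [Val.elems_list]

/-- b8 starts from a received beacon, and b9 consumes a tuple of the same name generated earlier,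
whence the strong induction. Both rules pass the interface list and the opaque fields on unchanged.
-/
theorem generates_beaconToVeri (h : 𝒯.HonestFrom n (scionProg bs) ⊥) (hk : k < 𝒯.len)
    {td itf tl ol sl sg v j : Val N}
    (hp : 𝒯.Generates ⟨.beaconToVeri, [.node n, td, itf, tl, ol, sl, sg, v, j]⟩ n k) :
    BeaconShape 𝒯 n k itf ol := by
  induction k using Nat.strong_induction_on generalizing td itf tl ol sl sg v j with
  | _ k ih =>
  rcases generates_scion_cases h hk hp with ⟨b, -, he⟩ | ⟨r, hr, hpred, now, σ, he, hbody, -, -⟩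
  · cases b <;> simp [BaseFact.toBase] at he
  · simp only [scionProg, List.mem_cons, List.not_mem_nil, or_false] at hr
    rcases hr with rfl | rfl | rfl | rfl | rfl | rfl | rfl | rfl | rfl | rfl | rfl | rfl | rfl |
      rfl | rfl | rfl | rfl <;> try cases hpred
    · simp only [b8, lit, Lit.inst, List.map_cons, List.map_nil, Term.eval, List.cons.injEq,
        and_true] at he
      obtain ⟨i, hi, hg⟩ := hbody (lit .beaconRev [.N, .Td, .Ing, .Itf, .Tl, .Ol, .Sl, .SigG])
        (by simp [b8]) (by simp [lit]) (by simp [lit]) (by simp [lit])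
      simp only [lit, Lit.inst, List.map_cons, List.map_nil, Term.eval, ← he.1] at hg
      rw [he.2.2.1, he.2.2.2.2.1]
      exact (generates_beaconRev h (hi.trans hk) hg).mono hi.le
    · simp only [b9, lit, Lit.inst, List.map_cons, List.map_nil, Term.eval, List.cons.injEq,
        and_true] at he
      obtain ⟨i, hi, hg⟩ := hbody
        (lit .beaconToVeri [.N, .Td, .Itf, .Tl, .Ol, .Sl, .SigG, .Itfv, .Pos])
        (by simp [b9]) (by simp [lit]) (by simp [lit]) (by simp [lit])
      simp only [lit, Lit.inst, List.map_cons, List.map_nil, Term.eval, ← he.1] at hg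
      rw [he.2.2.1, he.2.2.2.2.1]
      exact (ih i hi (hi.trans hk) hg).mono hi.le

theorem generates_verifiedBeacon (h : 𝒯.HonestFrom n (scionProg bs) ⊥) (hk : k < 𝒯.len)
    {td itf tl ol sl sg : Val N}
    (hp : 𝒯.Generates ⟨.verifiedBeacon, [.node n, td, itf, tl, ol, sl, sg]⟩ n k) :
    BeaconShape 𝒯 n k itf ol := by
  rcases generates_scion_cases h hk hp with ⟨b, -, he⟩ | ⟨r, hr, hpred, now, σ, he, hbody, -, -⟩
  · cases b <;> simp [BaseFact.toBase] at he
  · simp only [scionProg, List.mem_cons, List.not_mem_nil, or_false] at hr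
    rcases hr with rfl | rfl | rfl | rfl | rfl | rfl | rfl | rfl | rfl | rfl | rfl | rfl | rfl |
      rfl | rfl | rfl | rfl <;> try cases hpred
    simp only [b10, lit, Lit.inst, List.map_cons, List.map_nil, Term.eval, List.cons.injEq,
      and_true] at he
    obtain ⟨i, hi, hg⟩ := hbody
      (lit .beaconToVeri [.N, .Td, .Itf, .Tl, .Ol, .Sl, .SigG, .Itfv, .Pos])
      (by simp [b10]) (by simp [lit]) (by simp [lit]) (by simp [lit])
    simp only [lit, Lit.inst, List.map_cons, List.map_nil, Term.eval, ← he.1] at hg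
    rw [he.2.2.1, he.2.2.2.2.1]
    exact (generates_beaconToVeri h (hi.trans hk) hg).mono hi.le

/-! ### Origin of MACs. -/

/-- A MAC of at least two entries covers an ingress interface, an egress interface to a customer,
and the last opaque field of a verified beacon that came in through this ingress interface. -/
theorem generates_mac (h : 𝒯.HonestFrom n (scionProg bs) ⊥) (hk : k < 𝒯.len)
    {nig neg m : Val N} {f : List (Val N)}
    (hp : 𝒯.Generates ⟨.mac, [.node n, .list (nig :: neg :: f), m]⟩ n k) :
    ∃ c td itf tl ol sl sg, (∃ j < k, 𝒯.Generates ⟨.customer, [.node n, .node c, neg]⟩ n j) ∧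
      (∃ j < k, 𝒯.Generates ⟨.verifiedBeacon, [.node n, td, itf, tl, ol, sl, sg]⟩ n j) ∧
      itf.elems.getLastD (.list []) = nig ∧ (ol.elems.getLastD (.list [])).elems = f := by
  rcases generates_scion_cases h hk hp with ⟨b, -, he⟩ | ⟨r, hr, hpred, now, σ, he, hbody, hat, -⟩
  · cases b <;> simp [BaseFact.toBase] at he
  · simp only [scionProg, List.mem_cons, List.not_mem_nil, or_false] at hr
    rcases hr with rfl | rfl | rfl | rfl | rfl | rfl | rfl | rfl | rfl | rfl | rfl | rfl | rfl |
      rfl | rfl | rfl | rfl <;> try cases hpred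
    · simp only [b3, lit, Lit.inst, List.map_cons, List.map_nil, Term.eval, List.cons.injEq,
        and_true] at he
      -- The message of the core rule b3 has a single entry, so b3 is impossible here.
      have := hat (.assign .Info (tlist [Var.Ceg])) (by simp [b3])
      simp [Atom.Holds, ← he.2.1, tlist, Term.eval, Fn2.eval, Val.elems] at this
    · simp only [b12, lit, Lit.inst, List.map_cons, List.map_nil, Term.eval, List.cons.injEq,
        and_true] at he
      simp only [b12, tcons, tlast, List.mem_cons, List.not_mem_nil, or_false,
        forall_eq_or_imp, forall_eq, Atom.Holds, Term.eval, Fn2.eval, Fn1.eval, Val.elems_list,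
        ← he.2.1, Val.list.injEq, List.cons.injEq] at hat
      obtain ⟨hnig, ⟨rfl, rfl, hf⟩, -⟩ := hat
      obtain ⟨j, hj, hg⟩ := hbody (lit .customer [.N, .M, .Neg]) (by simp [b12])
        (by simp [lit]) (by simp [lit]) (by simp [lit])
      obtain ⟨i, hi, hv⟩ := hbody (lit .verifiedBeacon [.N, .Td, .Itf, .Tl, .Ol, .Sl, .SigG])
        (by simp [b12]) (by simp [lit]) (by simp [lit]) (by simp [lit])
      simp only [lit, Lit.inst, List.map_cons, List.map_nil, Term.eval, ← he.1] at hg hv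
      obtain ⟨c, hc⟩ := generates_customer h (hj.trans hk) hg
      rw [hc] at hg
      exact ⟨c, _, _, _, _, _, _, ⟨j, hj, hg⟩, ⟨i, hi, hv⟩, hnig.symm, hf.symm⟩

/-! ### Opaque fields and path uploads. -/

theorem getElem?_of_getD_eq {α : Type*} {l : List α} {i : ℕ} {d a : α} (hi : i < l.length)
    (h : l.getD i d = a) : l[i]? = some a := by
  simpa [List.getD_eq_getElem?_getD, hi] using h

/-- Turns lookups of two neighbouring fields, as pc3 makes them, into the decomposition displayed in
`GoodFwdPath`. -/
theorem eq_append_of_getElem? {α : Type*} {l : List α} {i : ℕ} {a b : α} (ha : l[i]? = some a)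
    (hb : l[i + 1]? = some b) : l = l.take i ++ [a, b] ++ l.drop (i + 2) := by
  obtain ⟨h1, rfl⟩ := List.getElem?_eq_some_iff.1 ha
  obtain ⟨h2, rfl⟩ := List.getElem?_eq_some_iff.1 hb
  rw [List.append_assoc]
  conv_lhs => rw [← List.take_append_drop i l, List.drop_eq_getElem_cons h1,
    List.drop_eq_getElem_cons h2]
  rfl

/-- A field of well-formed opaque fields is the final pair or a triple. -/
theorem WellFormedOpq.cases {l : List (Val N)} (h : WellFormedOpq (.list l)) {i : ℕ}
    (hi : i < l.length) :
    (∃ ceg mac, l[i]? = some (.list [ceg, mac]) ∧ i + 1 = l.length) ∨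
      ∃ ig eg mac, l[i]? = some (.list [ig, eg, mac]) := by
  obtain ⟨fs, ceg, mac, hl, hf⟩ := h
  cases hl
  by_cases hlt : i < fs.length
  · right
    obtain ⟨ig, eg, mac', he⟩ := hf fs[i] (List.getElem_mem hlt)
    exact ⟨ig, eg, mac', by rw [List.getElem?_append_left hlt, List.getElem?_eq_getElem hlt, he]⟩
  · left
    have : i = fs.length := by simp at hi; omega
    subst this
    exact ⟨ceg, mac, by simp, by simp⟩

/-- The uploads that a node sends: new ones, and those that it has checked. -/
theorem generates_pathUpload (h : 𝒯.HonestFrom n (scionProg bs) ⊥) (hk : k < 𝒯.len)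
    {m src core itf opqD opqU pt : Val N}
    (hp : 𝒯.Generates ⟨.pathUpload, [m, .node n, src, core, itf, opqD, opqU, pt]⟩ n k) :
    pt = .num 0 ∨ ∃ (l : List (Val N)) (i : ℕ) (nig neg mac key f : Val N),
      opqU = .list l ∧ pt = .num (i + 1) ∧ WellFormedOpq (.list l) ∧
      l[i]? = some (.list [nig, neg, mac]) ∧ l[i + 1]? = some f ∧
      (∃ j < k, 𝒯.Generates ⟨.privateKeys, [.node n, key]⟩ n j) ∧
      𝒯.VerifyMac (.list (nig :: neg :: f.elems)) mac key n (𝒯.time k) := by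
  rcases generates_scion_cases h hk hp with ⟨b, -, he⟩ | ⟨r, hr, hpred, now, σ, he, hbody, hat, hv⟩
  · cases b <;> simp [BaseFact.toBase] at he
  · simp only [scionProg, List.mem_cons, List.not_mem_nil, or_false] at hr
    rcases hr with rfl | rfl | rfl | rfl | rfl | rfl | rfl | rfl | rfl | rfl | rfl | rfl | rfl |
      rfl | rfl | rfl | rfl <;> try cases hpred
    · left
      simp only [pc2, lit, Lit.inst, List.map_cons, List.map_nil, Term.eval, List.cons.injEq,
        and_true] at he
      rw [he.2.2.2.2.2.2.2]
      exact hat (.assign .Pt (tnum 0)) (by simp [pc2])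
    · right
      simp only [pc3, lit, Lit.inst, List.map_cons, List.map_nil, Term.eval, List.cons.injEq,
        and_true] at he
      obtain ⟨-, hN, -, -, -, -, rfl, rfl⟩ := he
      specialize hv Var.Info Var.Mac Var.K (by simp [pc3, aeq, tnum])
      simp only [pc3, aeq, alt, tlist, tcons, tnth, tadd, tsize, tnum, List.mem_cons,
        List.not_mem_nil, or_false, forall_eq_or_imp, forall_eq, Atom.Holds, List.foldr, Term.eval,
        Fn1.eval, Fn2.eval, Val.elems_list] at hat
      obtain ⟨hwf, hpt, ⟨j, _, hj, hlen, hlt⟩, hnth, hinfo, -⟩ := hat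
      -- The test evaluates to 0 or 1, so equality with 1 says that the fields are well formed; in
      -- particular their value is a list.
      have hwf' : WellFormedOpq (σ .OpqU) := by
        by_contra hc
        simp [hc] at hwf
      obtain ⟨l, hl⟩ : ∃ l, σ .OpqU = .list l := by
        obtain ⟨_, _, _, hl, -⟩ := hwf'
        exact ⟨_, hl⟩
      rw [hl, Val.elems_list] at hnth hlen hinfo
      rw [hl] at hwf'
      -- The received position may be any value, a non-number being read as 0. The incremented
      -- position is a number in every case.
      change σ .Pt1 = .num ((σ .Pt).toNat + 1) at hpt
      rw [hpt] at hj hinfo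
      cases hj
      cases hlen
      obtain ⟨i, hi, hg⟩ := hbody (lit .privateKeys [.N, .K]) (by simp [pc3])
        (by simp [lit]) (by simp [lit]) (by simp [lit])
      simp only [lit, Lit.inst, List.map_cons, List.map_nil, Term.eval, ← hN] at hg
      simp only [Term.eval] at hv
      -- The bound on the new position puts both lookups inside the list, so neither returns the
      -- default value of `nth`.
      refine ⟨l, (σ .Pt).toNat, σ .Nig, σ .Neg, σ .Mac, σ .K,
        l.getD ((σ .Pt).toNat + 1) (.list []), hl, hpt, hwf',
        getElem?_of_getD_eq (by omega) hnth, getElem?_of_getD_eq (by omega) rfl, ⟨i, hi, hg⟩, ?_⟩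
      rw [hinfo] at hv
      exact hv

end ScionRules

end Scion

/-! ### Data-path authenticity. -/

theorem mainTheorem4 {N : Type*} {T : Type*} [LinearOrder T] (cr : Scion.Crypto (Scion.Val N))
    (base : N → List (Scion.BaseFact N)) (𝒯 : Scion.Trace cr T)
    (hmac : Scion.MacAxiom base 𝒯) :
    ∀ (m : Scion.Val N) (n : N) (t : T) (src core itf opqD opqU pt : Scion.Val N),
      Scion.Honest base 𝒯 n →
      𝒯.Derives ⟨.pathUpload, [m, .node n, src, core, itf, opqD, opqU, pt]⟩ n t →
      Scion.GoodFwdPath base 𝒯 t n opqU pt := by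
  open Scion in
  intro m n t src core itf opqD opqU pt hn ⟨k, hk, hkt, hp⟩
  have hn' : 𝒯.HonestFrom n (scionProg (base n)) ⊥ := hn
  have hder : ∀ {p : Tuple N}, (∃ j < k, 𝒯.Generates p n j) → 𝒯.Derives p n t :=
    fun ⟨j, hj, hg⟩ => ⟨j, hj.trans hk, (𝒯.mono j k hj.le hk).trans hkt, hg⟩
  rcases generates_pathUpload hn' hk hp with
    rfl | ⟨l, i, nig, neg, mac', key, f, rfl, rfl, hwf, h1, h2, ⟨j, hj, hg⟩, hv⟩
  · exact .unchecked _
  -- The key is the node's own, because pc3 takes it from a locally generated tuple; this is what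
  -- the axiom requires.
  obtain ⟨t', ht', k', hk', hkt', hm⟩ :=
    hmac _ _ _ _ _ hv ⟨j, hj.trans hk, 𝒯.mono j k hj.le hk, hg⟩ hn
  -- Time stamps may repeat, but the axiom gives a strictly earlier time, and monotonicity turns
  -- this into a smaller index.
  have hkk : k' < k := by
    by_contra hc
    exact absurd (((𝒯.mono k k' (not_lt.1 hc) hk').trans hkt').trans_lt ht') (lt_irrefl _)
  obtain ⟨c, td, itf, tl, ol, sl, sg, ⟨i₁, hi₁, hc⟩, ⟨i₂, hi₂, hvb⟩, hnig, hf⟩ :=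
    generates_mac hn' hk' hm
  obtain ⟨h, ing, ⟨i₃, hi₃, hpr⟩, hshape⟩ := generates_verifiedBeacon hn' (hi₂.trans hk') hvb
  replace hc := hder ⟨i₁, hi₁.trans hkk, hc⟩
  replace hvb := hder ⟨i₂, hi₂.trans hkk, hvb⟩
  replace hpr := hder ⟨i₃, hi₃.trans (hi₂.trans hkk), hpr⟩
  have hl := eq_append_of_getElem? h1 h2
  have hlen : i + 1 < l.length := (List.getElem?_eq_some_iff.1 h2).1
  have htake : i + 1 = (l.take i).length + 1 := by
    rw [List.length_take]
    omega
  -- The field after the checked one and the last field of the beacon have the same entries. The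
  -- closing `simp` refutes pair against triple by length.
  rcases hwf.cases hlen with ⟨ceg, mac, he, hlast⟩ | ⟨hig, heg, mac, he⟩ <;>
    cases h2.symm.trans he <;>
    rcases hshape with ⟨ceg', mac'', rfl, rfl⟩ | ⟨p', p'', hig', heg', mac'', rfl, rfl⟩ <;>
    simp [Val.elems_list] at hnig hf
  · obtain ⟨rfl, rfl⟩ := hf
    subst hnig
    -- A pair occurs only as the final field, so nothing follows it.
    rw [List.drop_eq_nil_of_le (by omega), List.append_nil] at hl
    -- The time `t` itself serves as witness, since `Trace.Derives` means "at this time or earlier".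
    have := GoodFwdPath.belowCore (base := base) (𝒯 := 𝒯) (t := t) (n := n)
      (l.take i) ing neg mac' ceg' mac'' (i + 1) i.succ_pos (by rw [← hl]; exact hlen) htake
      fun _ => ⟨t, le_rfl, h, c, hpr, hc, td, tl, sl, sg, hvb⟩
    rwa [← hl] at this
  · obtain ⟨rfl, rfl, rfl⟩ := hf
    subst hnig
    have := GoodFwdPath.inner (base := base) (𝒯 := 𝒯) (t := t) (n := n)
      (l.take i) (l.drop (i + 2)) ing neg mac' hig' heg' mac'' (i + 1) i.succ_pos
      (by rw [← hl]; exact hlen) htake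
      fun _ => ⟨t, le_rfl, h, c, hpr, hc, td, tl, sl, sg, p', p'', hvb⟩
    rwa [← hl] at this
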